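/- A field $K$ is called ample (or large) if every smooth curve $C$ over $K$ that has a $K$-rational point has infinitely many $K$-rational points; here a curve over $K$ is a one-dimensional, geometrically irreducible and geometrically reduced, separated scheme of finite type over $K$. Let $K$ be a perfect ample field, and let $X \subseteq K$ be an infinite set that is existentially $K$-definable, i.e. $X = \{x \in K : K \models \varphi(x)\}$ for some existential first-order formula $\varphi(x)$ in the language of rings with parameters from $K$. Then $$|X \setminus K_1| = |K|$$ for every proper subfield $K_1$ of $K$, where $|\cdot|$ denotes cardinality. -/

import Mathlib

universe u v w

open AlgebraicGeometry CategoryTheory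

/-- The `K`-rational points of a `K`-scheme `f : C ⟶ Spec K`, i.e. the sections of `f`. -/
abbrev RationalPoints {K : Type u} [Field K] {C : Scheme.{u}} (f : C ⟶ Spec (CommRingCat.of K)) :
    Type u :=
  {s : Spec (CommRingCat.of K) ⟶ C // s ≫ f = 𝟙 (Spec (CommRingCat.of K))}

/-- A smooth curve over the field `K`: a separated scheme of finite type over `K` that is
geometrically integral and smooth of relative dimension one (local finiteness is part of
smoothness). -/
structure IsSmoothCurve {K : Type u} [Field K] {C : Scheme.{u}}
    (f : C ⟶ Spec (CommRingCat.of K)) : Prop where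
  isSeparated : IsSeparated f
  quasiCompact : QuasiCompact f
  geometricallyIntegral : GeometricallyIntegral f
  smooth : SmoothOfRelativeDimension 1 f

/-- A field `K` is ample (or large) if every smooth curve over `K` that has a `K`-rational point
has infinitely many of them. -/
def IsAmpleField (K : Type u) [Field K] : Prop :=
  ∀ (C : Scheme.{u}) (f : C ⟶ Spec (CommRingCat.of K)), IsSmoothCurve f →
    Nonempty (RationalPoints f) → Infinite (RationalPoints f)

/-- A subset `X` of an `L`-structure `M` is existentially `A`-definable if it is the set of all
`x` satisfying some existential `L`-formula `φ(x)` with parameters from `A`. -/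
def IsExistentiallyDefinable (L : FirstOrder.Language.{v, w}) {M : Type u} [L.Structure M] (A X : Set M) :
    Prop :=
  ∃ φ : L.Formula (A ⊕ Unit), FirstOrder.Language.BoundedFormula.IsExistential φ ∧
    X = {x : M | φ.Realize (Sum.elim (fun a : A => (a : M)) (fun _ => x))}

/-!
An existentially definable set consists of the `a ∈ K` over which some `K[X]`-algebra `A` of finite
type has a `K`-point. If it is infinite, then there is a homomorphism from `A` to a function field
`F / K` such that `X` is transcendental in `F` and every `K`-algebra of finite type that maps to `F`
has a `K`-point. As `K` is perfect of characteristic exponent `p`, some `p ^ k`-th root `w` of `X`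
belongs to a separating transcendence basis of `F / K`, so that `A` maps to an étale algebra over an
affine space with `w` among the coordinates. Restricting to the line through a `K`-point in the
direction of `w` yields a nonempty set `T ⊆ K`, the image of the `K`-points of an étale algebra over
`K[X]`, with `b ^ p ^ k` in the given set for all `b ∈ T`.

Such sets `T` are stable under affine substitutions and finite intersections. Completion at a
`K`-point embeds a localization of an étale algebra over the line into `K⟦X⟧`, which makes it the
coordinate ring of a smooth curve; so by ampleness `T` is never a singleton. If `a ∈ T` and
`α ∉ K₁`, then for every `β` there is therefore some `s ≠ 0` for which `T` contains `u = a + c s`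
and `v = a + (β + c') s` for all `c, c' ∈ {1, α, 1 + α}`. Suitable `c` and `c'` make `u, v ∉ K₁`,
and `β = c (v - a) / (u - a) - c'` is determined by `u, v, c, c'`; hence `|K| ≤ |T \ K₁|`.
-/

section

open scoped Polynomial PowerSeries TensorProduct

theorem exists_comp_fst_or_exists_comp_snd {A B K : Type*} [CommRing A] [CommRing B] [CommRing K]
    [IsDomain K] (g : A × B →+* K) :
    (∃ h : A →+* K, h.comp (.fst A B) = g) ∨ ∃ h : B →+* K, h.comp (.snd A B) = g := by
  have hg : g (1, 0) * g (0, 1) = 0 := by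
    rw [← map_mul, Prod.mk_mul_mk, mul_zero, zero_mul, Prod.mk_zero_zero, map_zero]
  refine (mul_eq_zero.mp hg).symm.imp (fun h => ?_) (fun h => ?_)
  · refine ⟨RingHom.liftOfSurjective (.fst A B) Prod.fst_surjective ⟨g, ?_⟩,
      RingHom.liftOfRightInverse_comp _ _ _ _⟩
    rintro ⟨a, b⟩ (rfl : a = 0)
    rw [RingHom.mem_ker, ← mul_zero (g (0, b)), ← h, ← map_mul, Prod.mk_mul_mk, zero_mul, mul_one]
  · refine ⟨RingHom.liftOfSurjective (.snd A B) Prod.snd_surjective ⟨g, ?_⟩,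
      RingHom.liftOfRightInverse_comp _ _ _ _⟩
    rintro ⟨a, b⟩ (rfl : b = 0)
    rw [RingHom.mem_ker, ← mul_zero (g (a, 0)), ← h, ← map_mul, Prod.mk_mul_mk, zero_mul, mul_one]

/-- The set of homomorphisms `R →+* K` that extend along some `φ : R →+* A` with property `P`:
the image in `(Spec R)(K)` of the `K`-points of a scheme over `Spec R` with property `P`. For
`P = RingHom.Etale` these sets form a basis of the étale-open topology on `(Spec R)(K)`. -/
def IsPointImage (P : ∀ {R S : Type u} [CommRing R] [CommRing S], (R →+* S) → Prop)
    {R : Type u} {K : Type*} [CommRing R] [CommRing K] (S : Set (R →+* K)) : Prop :=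
  ∃ (A : Type u) (_ : CommRing A) (φ : R →+* A),
    P φ ∧ S = Set.range fun g : A →+* K => g.comp φ

namespace IsPointImage

section Closure

variable {P : ∀ {R S : Type u} [CommRing R] [CommRing S], (R →+* S) → Prop}
  {R R' : Type u} {K : Type*} [CommRing R] [CommRing R'] [CommRing K] {S T : Set (R →+* K)}

theorem image_comp (hP : RingHom.StableUnderComposition @P) {φ : R →+* R'} (hφ : P φ)
    {T : Set (R' →+* K)} (hT : IsPointImage @P T) :
    IsPointImage @P ((fun g : R' →+* K => g.comp φ) '' T) := by
  obtain ⟨A, _, ψ, hψ, rfl⟩ := hT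
  exact ⟨A, inferInstance, ψ.comp φ, hP φ ψ hφ hψ, by
    rw [← Set.range_comp]
    rfl⟩

theorem preimage_comp (hP : RingHom.IsStableUnderBaseChange @P) (hS : IsPointImage @P S)
    (φ : R →+* R') : IsPointImage @P ((fun f : R' →+* K => f.comp φ) ⁻¹' S) := by
  obtain ⟨A, _, ψ, hψ, rfl⟩ := hS
  let := φ.toAlgebra
  let := ψ.toAlgebra
  refine ⟨TensorProduct R R' A, inferInstance, algebraMap _ _, hP.tensorProduct R' hψ, ?_⟩
  ext f
  constructor
  · rintro ⟨g, hg⟩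
    let := (f.comp φ).toAlgebra
    let F : R' →ₐ[R] K := ⟨f, fun r => rfl⟩
    let G : A →ₐ[R] K := ⟨g, RingHom.congr_fun hg⟩
    exact ⟨(Algebra.TensorProduct.productMap F G).toRingHom,
      RingHom.ext (Algebra.TensorProduct.productMap_left_apply F G)⟩
  · rintro ⟨g, rfl⟩
    refine ⟨g.comp Algebra.TensorProduct.includeRight.toRingHom, RingHom.ext fun r => ?_⟩
    exact congrArg g ((AlgHom.commutes (Algebra.TensorProduct.includeRight : A →ₐ[R] _) r).trans
      (IsScalarTower.algebraMap_apply R R' _ r))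

theorem inter (hP : RingHom.IsStableUnderBaseChange @P) (hP' : RingHom.StableUnderComposition @P)
    (hS : IsPointImage @P S) (hT : IsPointImage @P T) : IsPointImage @P (S ∩ T) := by
  obtain ⟨A, _, φ, hφ, rfl⟩ := hS
  rw [Set.inter_comm, ← Set.image_preimage_eq_inter_range]
  exact (hT.preimage_comp hP φ).image_comp hP' hφ

theorem biInter (hP : RingHom.IsStableUnderBaseChange @P)
    (hP' : RingHom.StableUnderComposition @P) (hP'' : RingHom.ContainsIdentities @P)
    {ι : Type*} {s : Set ι} (hs : s.Finite) {S : ι → Set (R →+* K)}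
    (hS : ∀ i, IsPointImage @P (S i)) : IsPointImage @P (⋂ i ∈ s, S i) := by
  induction s, hs using Set.Finite.induction_on with
  | empty => exact ⟨R, inferInstance, .id R, hP'' R, by simp⟩
  | insert _ _ ih =>
    rw [Set.biInter_insert]
    exact (hS _).inter hP hP' ih

end Closure

section FiniteType

variable {R : Type u} {K : Type*} [CommRing R] [Field K] {S T : Set (R →+* K)}

theorem setOf_eq_zero (r : R) : IsPointImage @RingHom.FiniteType {f : R →+* K | f r = 0} := by
  refine ⟨R ⧸ Ideal.span {r}, inferInstance, Ideal.Quotient.mk _,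
    .of_surjective _ Ideal.Quotient.mk_surjective, Set.Subset.antisymm (fun f hf => ?_) ?_⟩
  · have hle : Ideal.span {r} ≤ RingHom.ker f := (Ideal.span_singleton_le_iff_mem _).mpr hf
    exact ⟨Ideal.Quotient.lift _ f hle, Ideal.Quotient.lift_comp_mk _ _ _⟩
  · rintro _ ⟨g, rfl⟩
    simp

theorem setOf_ne_zero (r : R) : IsPointImage @RingHom.FiniteType {f : R →+* K | f r ≠ 0} := by
  refine ⟨Localization.Away r, inferInstance, algebraMap _ _,
    RingHom.finiteType_algebraMap.mpr inferInstance,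
    Set.Subset.antisymm (fun f hf => ?_) ?_⟩
  · exact ⟨IsLocalization.Away.lift r (IsUnit.mk0 _ hf), IsLocalization.Away.lift_comp r _⟩
  · rintro _ ⟨g, rfl⟩
    exact ((IsLocalization.Away.algebraMap_isUnit r).map g).ne_zero

theorem union (hS : IsPointImage @RingHom.FiniteType S)
    (hT : IsPointImage @RingHom.FiniteType T) : IsPointImage @RingHom.FiniteType (S ∪ T) := by
  obtain ⟨A, _, φ, hφ, rfl⟩ := hS
  obtain ⟨B, _, ψ, hψ, rfl⟩ := hT
  algebraize [φ, ψ]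
  refine ⟨A × B, inferInstance, φ.prod ψ, RingHom.finiteType_algebraMap.mpr inferInstance,
    Set.Subset.antisymm ?_ ?_⟩
  · rintro _ (⟨g, rfl⟩ | ⟨g, rfl⟩)
    · exact ⟨g.comp (.fst A B), rfl⟩
    · exact ⟨g.comp (.snd A B), rfl⟩
  · rintro _ ⟨g, rfl⟩
    obtain ⟨h, rfl⟩ | ⟨h, rfl⟩ := exists_comp_fst_or_exists_comp_snd g
    · exact .inl ⟨h, rfl⟩
    · exact .inr ⟨h, rfl⟩

end FiniteType

end IsPointImage

section Formulas

open FirstOrder FirstOrder.Language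

variable {K : Type*} [Field K] [FirstOrder.Ring.CompatibleRing K] {α : Type u} {n : ℕ}

theorem exists_mvPolynomial_realize_eq (t : Language.ring.Term α) :
    ∃ p : MvPolynomial α ℤ, ∀ f : MvPolynomial α ℤ →+* K,
      t.realize (fun a => f (.X a)) = f p := by
  induction t with
  | var a => exact ⟨.X a, fun f => rfl⟩
  | func s ts ih =>
    choose p hp using ih
    cases s with
    | add => exact ⟨p 0 + p 1, fun f =>
        (FirstOrder.Ring.CompatibleRing.funMap_add _).trans (by simp [hp])⟩
    | mul => exact ⟨p 0 * p 1, fun f =>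
        (FirstOrder.Ring.CompatibleRing.funMap_mul _).trans (by simp [hp])⟩
    | neg => exact ⟨-p 0, fun f =>
        (FirstOrder.Ring.CompatibleRing.funMap_neg _).trans (by simp [hp])⟩
    | zero => exact ⟨0, fun f =>
        (FirstOrder.Ring.CompatibleRing.funMap_zero _).trans (by simp)⟩
    | one => exact ⟨1, fun f =>
        (FirstOrder.Ring.CompatibleRing.funMap_one _).trans (by simp)⟩

/-- The `K`-valued solutions of a ring formula, as `K`-points of the affine space over `ℤ` whose
coordinates are the free variables. -/
def solutionSet (K : Type*) [CommRing K] [FirstOrder.Ring.CompatibleRing K]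
    (φ : Language.ring.BoundedFormula α n) : Set (MvPolynomial (α ⊕ Fin n) ℤ →+* K) :=
  {f | φ.Realize (fun a => f (.X (.inl a))) fun i => f (.X (.inr i))}

theorem isPointImage_solutionSet_of_isQF {φ : Language.ring.BoundedFormula α n} (hφ : φ.IsQF) :
    IsPointImage @RingHom.FiniteType (solutionSet K φ) ∧
      IsPointImage @RingHom.FiniteType (solutionSet K φ)ᶜ := by
  induction hφ with
  | falsum =>
    have h : solutionSet K (.falsum : Language.ring.BoundedFormula α n) = {f | f 1 = 0} := by
      ext f
      simp [solutionSet, BoundedFormula.Realize]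
    rw [h]
    exact ⟨.setOf_eq_zero 1, .setOf_ne_zero 1⟩
  | of_isAtomic h =>
    cases h with
    | equal t s =>
      obtain ⟨p, hp⟩ := exists_mvPolynomial_realize_eq (K := K) t
      obtain ⟨q, hq⟩ := exists_mvPolynomial_realize_eq (K := K) s
      have h : solutionSet K (t =' s) = {f | f (p - q) = 0} := by
        ext f
        have helim : (Sum.elim (fun a => f (.X (.inl a))) fun i => f (.X (.inr i))) =
            fun v => f (.X v) :=
          Sum.elim_comp_inl_inr fun v => f (.X v)
        simp [solutionSet, BoundedFormula.realize_bdEqual, helim, hp, hq, sub_eq_zero]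
      rw [h]
      exact ⟨.setOf_eq_zero _, .setOf_ne_zero _⟩
    | rel R => exact isEmptyElim R
  | @imp φ ψ _ _ hφ hψ =>
    have h : solutionSet K (φ.imp ψ) = (solutionSet K φ)ᶜ ∪ solutionSet K ψ := by
      ext f
      exact BoundedFormula.realize_imp.trans imp_iff_not_or
    rw [h, Set.compl_union, compl_compl]
    exact ⟨hφ.2.union hψ.1, hφ.1.inter RingHom.finiteType_isStableUnderBaseChange
      RingHom.finiteType_stableUnderComposition hψ.2⟩

/-- Regards the last bound variable as the indeterminate of a polynomial ring over the others. -/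
noncomputable def toPolynomialLastVar (α : Type*) (n : ℕ) :
    MvPolynomial (α ⊕ Fin (n + 1)) ℤ →+* (MvPolynomial (α ⊕ Fin n) ℤ)[X] :=
  (MvPolynomial.aeval (Sum.elim (fun a => .C (.X (.inl a)))
    (Fin.snoc (fun i => .C (.X (.inr i))) .X))).toRingHom

theorem comp_toPolynomialLastVar_mem_solutionSet_iff
    {φ : Language.ring.BoundedFormula α (n + 1)} (g : (MvPolynomial (α ⊕ Fin n) ℤ)[X] →+* K) :
    g.comp (toPolynomialLastVar α n) ∈ solutionSet K φ ↔ φ.Realize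
      (fun a => g (.C (.X (.inl a)))) (Fin.snoc (fun i => g (.C (.X (.inr i)))) (g .X)) := by
  have hinl (a : α) : toPolynomialLastVar α n (.X (.inl a)) = .C (.X (.inl a)) := by
    simp [toPolynomialLastVar]
  have hinr (i : Fin (n + 1)) : g (toPolynomialLastVar α n (.X (.inr i))) =
      (Fin.snoc (fun i => g (.C (.X (.inr i)))) (g .X) : Fin (n + 1) → K) i := by
    cases i using Fin.lastCases <;> simp [toPolynomialLastVar]
  simp only [solutionSet, Set.mem_ofPred_eq, RingHom.comp_apply, hinl, hinr]

theorem solutionSet_ex (φ : Language.ring.BoundedFormula α (n + 1)) :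
    solutionSet K φ.ex = (fun g : (MvPolynomial (α ⊕ Fin n) ℤ)[X] →+* K => g.comp Polynomial.C) ''
      ((fun g => g.comp (toPolynomialLastVar α n)) ⁻¹' solutionSet K φ) := by
  ext f
  refine BoundedFormula.realize_ex.trans ⟨?_, ?_⟩
  · rintro ⟨x, hx⟩
    refine ⟨Polynomial.eval₂RingHom f x, ?_, RingHom.ext fun r => Polynomial.eval₂_C f x⟩
    rw [Set.mem_preimage, comp_toPolynomialLastVar_mem_solutionSet_iff]
    simpa using hx
  · rintro ⟨g, hg, rfl⟩
    exact ⟨g .X, (comp_toPolynomialLastVar_mem_solutionSet_iff g).mp hg⟩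

theorem isPointImage_solutionSet {φ : Language.ring.BoundedFormula α n} (hφ : φ.IsExistential) :
    IsPointImage @RingHom.FiniteType (solutionSet K φ) := by
  induction hφ with
  | of_isQF h => exact (isPointImage_solutionSet_of_isQF h).1
  | ex _ ih =>
    rw [solutionSet_ex]
    exact (ih.preimage_comp RingHom.finiteType_isStableUnderBaseChange _).image_comp
      RingHom.finiteType_stableUnderComposition
        (RingHom.finiteType_algebraMap.mpr inferInstance)

end Formulas

theorem IsExistentiallyDefinable.exists_isPointImage {K : Type u} [Field K]
    [FirstOrder.Ring.CompatibleRing K] {A X : Set K}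
    (hX : IsExistentiallyDefinable FirstOrder.Language.ring A X) :
    ∃ S : Set (K[X] →+* K), IsPointImage @RingHom.FiniteType S ∧
      X = {a | Polynomial.evalRingHom a ∈ S} := by
  obtain ⟨φ, hφ, rfl⟩ := hX
  let coord : MvPolynomial ((A ⊕ Unit) ⊕ Fin 0) ℤ →+* K[X] := (MvPolynomial.aeval
    (Sum.elim (Sum.elim (fun c : A => .C (c : K)) fun _ => .X) finZeroElim)).toRingHom
  refine ⟨_, (isPointImage_solutionSet hφ).preimage_comp
    RingHom.finiteType_isStableUnderBaseChange coord, Set.ext fun x => ?_⟩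
  have hcoord (v : A ⊕ Unit) : Polynomial.evalRingHom x (coord (.X (.inl v))) =
      Sum.elim (fun a : A => (a : K)) (fun _ => x) v := by
    cases v <;> simp [coord]
  simp only [Set.mem_ofPred_eq, Set.mem_preimage, solutionSet, RingHom.comp_apply, hcoord]
  exact (FirstOrder.Language.Formula.boundedFormula_realize_eq_realize φ _ _).symm

theorem isStandardSmoothOfRelativeDimension_one_polynomial (R : Type*) [CommRing R] [Nontrivial R] :
    Algebra.IsStandardSmoothOfRelativeDimension 1 R R[X] := by
  let b : Module.Basis Unit R[X] Ω[R[X]⁄R] :=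
    (Module.Basis.singleton Unit R[X]).map (KaehlerDifferential.polynomialEquiv R).symm
  have hb : Set.range b ⊆ Set.range (KaehlerDifferential.D R R[X]) := by
    rintro _ ⟨i, rfl⟩
    exact ⟨Polynomial.X, by simp [b]⟩
  have := Algebra.IsStandardSmooth.of_basis_kaehlerDifferential b hb
  rw [Algebra.IsStandardSmoothOfRelativeDimension.iff_of_isStandardSmooth,
    rank_eq_card_basis b]
  simp

theorem isDomain_tensorProduct_of_injective_powerSeries {K B L : Type*} [Field K]
    [CommRing B] [Algebra K B] [Field L] [Algebra K L] (f : B →ₐ[K] K⟦X⟧)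
    (hf : Function.Injective f) : IsDomain (B ⊗[K] L) := by
  let g : B →ₐ[K] L⟦X⟧ := (PowerSeries.mapAlgHom (Algebra.ofId K L)).comp f
  let h : L →ₐ[K] L⟦X⟧ := IsScalarTower.toAlgHom K L L⟦X⟧
  let F : B ⊗[K] L →ₐ[K] L⟦X⟧ := Algebra.TensorProduct.lift g h fun _ _ => Commute.all _ _
  suffices hF : Function.Injective F from hF.isDomain F.toRingHom
  rw [injective_iff_map_eq_zero]
  intro z hz
  let b := Module.Basis.ofVectorSpace K L
  obtain ⟨c, rfl⟩ := TensorProduct.eq_repr_basis_right b z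
  suffices hc : c = 0 by simp [hc]
  ext i
  refine hf (PowerSeries.ext fun n => ?_)
  have hn := congrArg (PowerSeries.coeff n) hz
  have hF (m : B) (l : L) : PowerSeries.coeff n (F (m ⊗ₜ l)) = PowerSeries.coeff n (f m) • l := by
    have : PowerSeries.mapAlgHom (Algebra.ofId K L) (f m) =
        PowerSeries.map (algebraMap K L) (f m) := rfl
    simp [F, g, h, Algebra.smul_def, this]
  rw [Finsupp.sum, map_sum, map_sum] at hn
  simp only [hF, map_zero] at hn
  by_cases hi : i ∈ c.support
  · simpa using linearIndependent_iff'.mp b.linearIndependent c.support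
      (fun i => PowerSeries.coeff n (f (c i))) hn i hi
  · simp [Finsupp.notMem_support_iff.mp hi]

theorem exists_algHom_powerSeries_eq_trunc {K S : Type*} [CommRing K] [CommRing S]
    [Algebra K[X] S] {n : ℕ} (hn : algebraMap K[X] S Polynomial.X ^ n = 0) :
    ∃ ρ : K⟦X⟧ →ₐ[K[X]] S, ∀ f, ρ f = algebraMap K[X] S (PowerSeries.trunc n f) := by
  have trunc_coe (p : K[X]) :
      algebraMap K[X] S (PowerSeries.trunc n (p : K⟦X⟧)) = algebraMap K[X] S p := by
    have : (Polynomial.X : K[X]) ^ n ∣ p - PowerSeries.trunc n (p : K⟦X⟧) := by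
      rw [Polynomial.X_pow_dvd_iff]
      intro d hd
      simp [PowerSeries.coeff_trunc, hd]
    obtain ⟨q, hq⟩ := this
    have := congrArg (algebraMap K[X] S) hq
    rw [map_mul, map_pow, hn, zero_mul, map_sub, sub_eq_zero] at this
    exact this.symm
  let ρ : K⟦X⟧ →+* S :=
    { toFun f := algebraMap K[X] S (PowerSeries.trunc n f)
      map_one' := by simpa using trunc_coe 1
      map_zero' := by simp
      map_add' f g := by simp
      map_mul' f g := by
        rw [← map_mul, ← trunc_coe (_ * _), Polynomial.coe_mul,
          PowerSeries.trunc_trunc_mul_trunc] }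
  exact ⟨⟨ρ, fun p => trunc_coe p⟩, fun _ => rfl⟩

section FormalExpansion

variable {K B : Type*} [Field K] [CommRing B] [Algebra K[X] B]

theorem ker_le_ker_constantCoeff_pow [Algebra.FormallyUnramified K[X] B]
    (Φ : B →ₐ[K[X]] K⟦X⟧) (n : ℕ) :
    RingHom.ker Φ ≤ (RingHom.ker (PowerSeries.constantCoeff.comp Φ.toRingHom)) ^ n := by
  set m := RingHom.ker (PowerSeries.constantCoeff.comp Φ.toRingHom)
  have hX : algebraMap K[X] B Polynomial.X ∈ m := by
    simp [m, RingHom.mem_ker, PowerSeries.algebraMap_apply']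
  have hn : algebraMap K[X] (B ⧸ m ^ (n + 1)) Polynomial.X ^ (n + 1) = 0 := by
    rw [IsScalarTower.algebraMap_apply K[X] B, ← map_pow]
    exact Ideal.Quotient.eq_zero_iff_mem.mpr (Ideal.pow_mem_pow hX _)
  obtain ⟨ρ, hρ⟩ := exists_algHom_powerSeries_eq_trunc hn
  have hle : m ^ (n + 1) ≤ m := Ideal.pow_le_self (by simp)
  -- Both maps reduce to the quotient map modulo `m`, so they agree as `K[X] → B` is unramified.
  have key : ρ.comp Φ = Ideal.Quotient.mkₐ K[X] (m ^ (n + 1)) := by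
    refine Algebra.FormallyUnramified.ext' (Ideal.Quotient.factor hle) ?_ _ _ fun b => ?_
    · refine ⟨n + 1, ?_⟩
      rw [Ideal.Quotient.factor_ker, ← Ideal.map_pow]
      simp
    · change Ideal.Quotient.factor hle (ρ (Φ b)) = Ideal.Quotient.mk m b
      have hX' : (Polynomial.X : K[X]) ∣ PowerSeries.trunc (n + 1) (Φ b) -
          Polynomial.C (PowerSeries.constantCoeff (Φ b)) := by
        rw [Polynomial.X_dvd_iff]
        simp [PowerSeries.coeff_trunc]
      obtain ⟨q, hq⟩ := hX'
      rw [hρ, IsScalarTower.algebraMap_apply K[X] B, Ideal.Quotient.algebraMap_eq,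
        Ideal.Quotient.factor_mk, sub_eq_iff_eq_add.mp hq, map_add, map_mul, map_add, map_mul,
        Ideal.Quotient.eq_zero_iff_mem.mpr hX, zero_mul, zero_add, Ideal.Quotient.eq,
        RingHom.mem_ker]
      simp [PowerSeries.algebraMap_apply']
  intro b hb
  have := congrArg (fun t => t b) key
  have hb' : Φ b = 0 := hb
  simp only [AlgHom.comp_apply, hb', map_zero] at this
  exact Ideal.pow_le_pow_right (Nat.le_succ n) (Ideal.Quotient.eq_zero_iff_mem.mp this.symm)

theorem exists_isUnit_forall_mul_eq_zero [Algebra.Etale K[X] B] (Φ : B →ₐ[K[X]] K⟦X⟧) :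
    ∃ r : B, IsUnit (Φ r) ∧ ∀ b, Φ b = 0 → r * b = 0 := by
  have : IsNoetherianRing B := Algebra.FiniteType.isNoetherianRing K[X] B
  set m := RingHom.ker (PowerSeries.constantCoeff.comp Φ.toRingHom)
  have hker : RingHom.ker Φ ≤ m • RingHom.ker Φ := fun b hb => by
    have hb' : b ∈ (⨅ n : ℕ, m ^ n • ⊤ : Ideal B) := by
      simp only [Submodule.mem_iInf, smul_eq_mul, Ideal.mul_top]
      exact fun n => ker_le_ker_constantCoeff_pow Φ n hb
    obtain ⟨r, hr⟩ := (m.mem_iInf_smul_pow_eq_bot_iff b).mp hb'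
    exact hr ▸ Submodule.smul_mem_smul r.2 hb
  obtain ⟨r, hrm, hr⟩ := Submodule.exists_mem_and_smul_eq_self_of_fg_of_le_smul m (RingHom.ker Φ)
    (IsNoetherian.noetherian _) hker
  refine ⟨1 - r, ?_, fun b hb => ?_⟩
  · have hr0 : PowerSeries.constantCoeff (Φ r) = 0 := hrm
    simp [PowerSeries.isUnit_iff_constantCoeff, hr0]
  · rw [sub_mul, one_mul, sub_eq_zero]
    exact (hr b hb).symm

theorem exists_injective_localizationAway (Φ : B →ₐ[K[X]] K⟦X⟧) {r : B} (hr : IsUnit (Φ r))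
    (hker : ∀ b, Φ b = 0 → r * b = 0) :
    ∃ Φ' : Localization.Away r →ₐ[K[X]] K⟦X⟧, Function.Injective Φ' := by
  have hunits (s : Submonoid.powers r) : IsUnit (Φ s) := by
    obtain ⟨_, n, rfl⟩ := s
    simpa using hr.pow n
  refine ⟨IsLocalization.liftAlgHom hunits, (injective_iff_map_eq_zero _).mpr fun z hz => ?_⟩
  obtain ⟨b, s, rfl⟩ := IsLocalization.exists_mk'_eq (Submonoid.powers r) z
  have hb : Φ b = 0 := by
    have hmap := congrArg (IsLocalization.liftAlgHom (S := Localization.Away r) hunits)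
      (IsLocalization.mk'_spec (Localization.Away r) b s)
    rw [map_mul, hz, zero_mul] at hmap
    simpa using hmap.symm
  exact (IsLocalization.mk'_eq_zero_iff b s).mpr ⟨⟨r, Submonoid.mem_powers r⟩, hker b hb⟩

end FormalExpansion

theorem exists_algHom_of_rationalPoints {K B : Type u} [Field K] [CommRing B] [Algebra K B]
    (s : RationalPoints (Spec.map (CommRingCat.ofHom (algebraMap K B)))) :
    ∃ g : B →ₐ[K] K, s.1 = Spec.map (CommRingCat.ofHom g.toRingHom) := by
  obtain ⟨s, hs⟩ := s
  obtain ⟨g, rfl⟩ := Spec.map_surjective s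
  rw [← Spec.map_comp, ← Spec.map_id] at hs
  have hg := congrArg CommRingCat.Hom.hom (Spec.map_injective hs)
  exact ⟨⟨g.hom, RingHom.congr_fun hg⟩, rfl⟩

section EtaleOverLine

variable {K B : Type u} [Field K] [CommRing B] [Algebra K B] [Algebra K[X] B]
  [IsScalarTower K K[X] B]

theorem isSmoothCurve_of_etale_polynomial [Algebra.Etale K[X] B] (f : B →ₐ[K] K⟦X⟧)
    (hf : Function.Injective f) :
    IsSmoothCurve (Spec.map (CommRingCat.ofHom (algebraMap K B))) := by
  refine ⟨inferInstance, inferInstance, ⟨?_⟩, ?_⟩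
  · rw [geometrically_iff_of_commRing]
    intro L _ _ Y fst snd h
    have := isDomain_tensorProduct_of_injective_powerSeries (L := L) f hf
    let e := h.isoPullback ≪≫ pullbackSpecIso K B L
    have : IsIntegral (Spec (CommRingCat.of (B ⊗[K] L))) := inferInstance
    have : Nonempty Y := ⟨e.inv (Classical.arbitrary _)⟩
    exact isIntegral_of_isOpenImmersion e.hom
  · have := isStandardSmoothOfRelativeDimension_one_polynomial K
    have : Algebra.IsStandardSmoothOfRelativeDimension 0 K[X] B :=
      Algebra.Etale.iff_isStandardSmoothOfRelativeDimension_zero.mp inferInstance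
    have := Algebra.IsStandardSmoothOfRelativeDimension.trans 1 0 K K[X] B
    rw [HasRingHomProperty.Spec_iff (P := @SmoothOfRelativeDimension 1)]
    refine RingHom.locally_of RingHom.isStandardSmoothOfRelativeDimension_respectsIso _ ?_
    exact (RingHom.isStandardSmoothOfRelativeDimension_algebraMap 1).mpr this

theorem IsAmpleField.infinite_algHom (hK : IsAmpleField K) [Algebra.Etale K[X] B]
    (f : B →ₐ[K] K⟦X⟧) (hf : Function.Injective f) : Infinite (B →ₐ[K] K) := by
  have hpoint : Nonempty (RationalPoints (Spec.map (CommRingCat.ofHom (algebraMap K B)))) := by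
    refine ⟨Spec.map (CommRingCat.ofHom (PowerSeries.constantCoeff.comp f.toRingHom)), ?_⟩
    rw [← Spec.map_comp, ← Spec.map_id, ← CommRingCat.ofHom_comp]
    congr 1
    ext r
    simp
  have := hK _ _ (isSmoothCurve_of_etale_polynomial f hf) hpoint
  choose G hG using exists_algHom_of_rationalPoints (K := K) (B := B)
  exact Infinite.of_injective G fun s t h => Subtype.ext (by rw [hG, hG, h])

theorem nonempty_algHom_powerSeries [Algebra.FormallySmooth K[X] B]
    (ψ : B →ₐ[K] K) (hψ : ψ (algebraMap K[X] B Polynomial.X) = 0) :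
    Nonempty (B →ₐ[K[X]] K⟦X⟧) := by
  let I : Ideal K⟦X⟧ := .span {PowerSeries.X}
  have hψ' (p : K[X]) : ψ (algebraMap K[X] B p) = p.coeff 0 := by
    have : ψ.comp (IsScalarTower.toAlgHom K K[X] B) = Polynomial.aeval 0 :=
      Polynomial.algHom_ext (by simpa using hψ)
    simpa [Polynomial.coeff_zero_eq_aeval_zero] using congrArg (fun t => t p) this
  let f : B →ₐ[K[X]] K⟦X⟧ ⧸ I :=
    { __ := (algebraMap K (K⟦X⟧ ⧸ I)).comp ψ.toRingHom
      commutes' p := by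
        change algebraMap K (K⟦X⟧ ⧸ I) (ψ (algebraMap K[X] B p)) = _
        rw [hψ', IsScalarTower.algebraMap_apply K K⟦X⟧, IsScalarTower.algebraMap_apply K[X] K⟦X⟧,
          Ideal.Quotient.algebraMap_eq, Ideal.Quotient.eq, Ideal.mem_span_singleton,
          PowerSeries.X_dvd_iff]
        simp [PowerSeries.algebraMap_apply'] }
  obtain ⟨Φ, -⟩ := Algebra.FormallySmooth.exists_mkₐ_comp_eq_of_isAdicComplete f
  exact ⟨Φ⟩

theorem finite_setOf_algHom_X_eq_zero [Algebra.FormallyUnramified K[X] B]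
    [Algebra.FiniteType K[X] B] :
    {g : B →ₐ[K] K | g (algebraMap K[X] B Polynomial.X) = 0}.Finite := by
  let I : Ideal B := .span {algebraMap K[X] B Polynomial.X}
  let := (Polynomial.evalRingHom (0 : K)).toAlgebra
  have tower : IsScalarTower K[X] K (B ⧸ I) := by
    refine .of_algebraMap_eq' (Polynomial.ringHom_ext (fun a => ?_) ?_)
    · change algebraMap K[X] (B ⧸ I) (algebraMap K K[X] a) =
        algebraMap K (B ⧸ I) (Polynomial.eval 0 (Polynomial.C a))
      rw [← IsScalarTower.algebraMap_apply, Polynomial.eval_C]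
    · change algebraMap K[X] (B ⧸ I) Polynomial.X =
        algebraMap K (B ⧸ I) (Polynomial.eval 0 Polynomial.X)
      rw [IsScalarTower.algebraMap_apply K[X] B, Polynomial.eval_X, map_zero]
      exact Ideal.Quotient.eq_zero_iff_mem.mpr (Ideal.mem_span_singleton_self _)
  have : Algebra.FormallyUnramified B (B ⧸ I) := .quotient _
  have : Algebra.FormallyUnramified K[X] (B ⧸ I) := .comp _ B _
  have : Algebra.FormallyUnramified K (B ⧸ I) := .of_restrictScalars K[X] _ _
  have : Algebra.FiniteType K[X] (B ⧸ I) := .trans (S := B) inferInstance inferInstance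
  have : Algebra.FiniteType K (B ⧸ I) := .of_restrictScalars_finiteType K[X] _ _
  have : Module.Finite K (B ⧸ I) := Algebra.FormallyUnramified.finite_of_free K _
  have hfin : Finite ((B ⧸ I) →ₐ[K] K) := inferInstance
  refine (Set.finite_range fun g : (B ⧸ I) →ₐ[K] K => g.comp (Ideal.Quotient.mkₐ K I)).subset ?_
  intro g hg
  refine ⟨Ideal.Quotient.liftₐ I g fun b hb => ?_, AlgHom.ext fun b => rfl⟩
  have : I ≤ RingHom.ker g := by
    rw [Ideal.span_singleton_le_iff_mem]
    exact hg
  exact this hb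

theorem IsAmpleField.exists_algHom_ne_zero (hK : IsAmpleField K) [Algebra.Etale K[X] B]
    (ψ : B →ₐ[K] K) (hψ : ψ (algebraMap K[X] B Polynomial.X) = 0) :
    ∃ g : B →ₐ[K] K, g (algebraMap K[X] B Polynomial.X) ≠ 0 := by
  obtain ⟨Φ⟩ := nonempty_algHom_powerSeries ψ hψ
  obtain ⟨r, hr, hker⟩ := exists_isUnit_forall_mul_eq_zero Φ
  obtain ⟨Φ', hΦ'⟩ := exists_injective_localizationAway Φ hr hker
  have : Infinite (Localization.Away r →ₐ[K] K) := hK.infinite_algHom (Φ'.restrictScalars K) hΦ'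
  obtain ⟨g, hg⟩ :=
    (finite_setOf_algHom_X_eq_zero (K := K) (B := Localization.Away r)).exists_notMem
  refine ⟨g.comp (IsScalarTower.toAlgHom K B _), fun h => hg ?_⟩
  rw [Set.mem_ofPred_eq, IsScalarTower.algebraMap_apply K[X] B]
  exact h

end EtaleOverLine

section EtaleImagesOnLine

variable {K : Type u} [Field K] {S : Set (K[X] →+* K)}

theorem IsAmpleField.exists_ne_zero_evalRingHom_mem (hK : IsAmpleField K)
    (hS : IsPointImage @RingHom.Etale S) (h0 : Polynomial.evalRingHom 0 ∈ S) :
    ∃ a ≠ 0, Polynomial.evalRingHom a ∈ S := by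
  obtain ⟨B, _, φ, hφ, rfl⟩ := hS
  obtain ⟨g, hg⟩ := h0
  algebraize [φ, φ.comp Polynomial.C]
  let ψ : B →ₐ[K] K := ⟨g, fun c => (RingHom.congr_fun hg (.C c)).trans (Polynomial.eval_C)⟩
  obtain ⟨h, hh⟩ := hK.exists_algHom_ne_zero ψ
    ((RingHom.congr_fun hg .X).trans Polynomial.eval_X)
  refine ⟨_, hh, h.toRingHom, Polynomial.ringHom_ext (fun c => ?_) ?_⟩
  · exact (h.commutes c).trans Polynomial.eval_C.symm
  · exact Polynomial.eval_X.symm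

theorem IsAmpleField.infinite (hK : IsAmpleField K) : Infinite K := by
  have := hK.infinite_algHom (B := K[X]) (Polynomial.coeToPowerSeries.algHom K)
    (Polynomial.coe_injective K)
  exact Infinite.of_injective (fun g : K[X] →ₐ[K] K => g .X) fun _ _ => Polynomial.algHom_ext

theorem evalRingHom_comp_compRingHom {R : Type*} [CommSemiring R] (b : R) (q : R[X]) :
    (Polynomial.evalRingHom b).comp (Polynomial.compRingHom q) =
      Polynomial.evalRingHom (q.eval b) :=
  RingHom.ext fun _ => Polynomial.eval_comp

theorem IsAmpleField.exists_ne_zero_forall_add_mul_mem (hK : IsAmpleField K)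
    (hS : IsPointImage @RingHom.Etale S) {a : K} (ha : Polynomial.evalRingHom a ∈ S)
    {Γ : Set K} (hΓ : Γ.Finite) : ∃ s ≠ 0, ∀ γ ∈ Γ, Polynomial.evalRingHom (a + γ * s) ∈ S := by
  let line (γ : K) : K[X] →+* K[X] := Polynomial.compRingHom (.C a + .C γ * .X)
  have hline (γ s : K) :
      (Polynomial.evalRingHom s).comp (line γ) = Polynomial.evalRingHom (a + γ * s) := by
    simp [line, evalRingHom_comp_compRingHom]
  have hT : IsPointImage @RingHom.Etale (⋂ γ ∈ Γ, (fun f : K[X] →+* K => f.comp (line γ)) ⁻¹' S) :=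
    .biInter RingHom.Etale.isStableUnderBaseChange RingHom.Etale.stableUnderComposition
      RingHom.Etale.containsIdentities hΓ fun γ =>
        hS.preimage_comp RingHom.Etale.isStableUnderBaseChange (line γ)
  obtain ⟨s, hs, hmem⟩ := hK.exists_ne_zero_evalRingHom_mem hT (by simp [hline, ha])
  exact ⟨s, hs, by simpa [hline] using hmem⟩

theorem exists_add_mul_notMem_subfield {K : Type*} [Field K] {K₁ : Subfield K} {α : K}
    (hα : α ∉ K₁) (a : K) {s : K} (hs : s ≠ 0) :
    ∃ c ∈ ({1, α, 1 + α} : Set K), a + c * s ∉ K₁ := by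
  by_contra! h
  have h₁ : a + s ∈ K₁ := by simpa using h 1 (by simp)
  have hα' : a + α * s ∈ K₁ := h α (by simp)
  have h₂ : a + (1 + α) * s ∈ K₁ := h (1 + α) (by simp)
  have hs₁ : s ∈ K₁ := by simpa [add_mul] using K₁.sub_mem h₂ hα'
  have hαs : α * s ∈ K₁ := by simpa [add_mul] using K₁.sub_mem h₂ h₁
  exact hα (by simpa [hs] using K₁.div_mem hαs hs₁)

theorem mk_le_mk_of_surjective_prod {D C K : Type u} [Infinite K] [Finite C]
    {F : (D × D) × C → K} (hF : Function.Surjective F) : Cardinal.mk K ≤ Cardinal.mk D := by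
  have : Infinite D := by
    by_contra hD
    rw [not_infinite_iff_finite] at hD
    exact (Finite.of_surjective F hF).not_infinite ‹_›
  calc Cardinal.mk K ≤ Cardinal.mk D * Cardinal.mk D * Cardinal.mk C :=
        Cardinal.mk_le_of_surjective hF
    _ ≤ Cardinal.mk D := by
        have hD := Cardinal.aleph0_le_mk D
        rw [Cardinal.mul_eq_self hD]
        exact (Cardinal.mul_le_max_of_aleph0_le_left hD).trans
          (max_le le_rfl (Cardinal.mk_le_aleph0.trans hD))

theorem IsAmpleField.mk_diff_subfield (hK : IsAmpleField K) (hS : IsPointImage @RingHom.Etale S)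
    {a : K} (ha : Polynomial.evalRingHom a ∈ S) {K₁ : Subfield K} (hK₁ : K₁ ≠ ⊤) :
    Cardinal.mk ↥({b | Polynomial.evalRingHom b ∈ S} \ (K₁ : Set K)) = Cardinal.mk K := by
  have := hK.infinite
  obtain ⟨α, -, hα⟩ := SetLike.exists_of_lt hK₁.lt_top
  let C : Set K := {1, α, 1 + α}
  have hC {c : K} (hc : c ∈ C) : c ≠ 0 := by
    rintro rfl
    obtain h | h | h : 0 = 1 ∨ 0 = α ∨ 0 = 1 + α := by simpa [C] using hc
    · exact zero_ne_one h
    · exact hα (h ▸ K₁.zero_mem)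
    · exact hα (eq_neg_of_add_eq_zero_right h.symm ▸ K₁.neg_mem K₁.one_mem)
  let D := {b | Polynomial.evalRingHom b ∈ S} \ (K₁ : Set K)
  let F : (D × D) × (C × C) → K := fun t => (t.1.2 - a) / (t.1.1 - a) * t.2.1 - t.2.2
  refine le_antisymm (Cardinal.mk_set_le _) (mk_le_mk_of_surjective_prod (F := F) fun β => ?_)
  obtain ⟨s, hs, hmem⟩ := hK.exists_ne_zero_forall_add_mul_mem hS ha
    ((Set.toFinite C).union ((Set.toFinite C).image (β + ·)))
  obtain ⟨c, hc, hu⟩ := exists_add_mul_notMem_subfield hα a hs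
  obtain ⟨c', hc', hv⟩ := exists_add_mul_notMem_subfield hα (a + β * s) hs
  rw [add_assoc, ← add_mul] at hv
  have hu' := hmem c (.inl hc)
  have hv' := hmem (β + c') (.inr ⟨c', hc', rfl⟩)
  refine ⟨((⟨_, hu', hu⟩, ⟨_, hv', hv⟩), (⟨c, hc⟩, ⟨c', hc'⟩)), ?_⟩
  have hc0 := hC hc
  simp only [F, add_sub_cancel_left]
  field_simp
  ring

end EtaleImagesOnLine

section RationalPointsOfQuotients

variable {K D : Type*} [Field K] [CommRing D] [Algebra K D]

theorem exists_ideal_infinite_values_finite_values [IsNoetherianRing D] {x : D}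
    (hx : {a | ∃ f : D →ₐ[K] K, f x = a}.Infinite) :
    ∃ I : Ideal D, {a | ∃ f : D ⧸ I →ₐ[K] K, f (Ideal.Quotient.mk I x) = a}.Infinite ∧
      ∀ g ≠ 0, {a | ∃ f : D ⧸ I →ₐ[K] K, f g = 0 ∧ f (Ideal.Quotient.mk I x) = a}.Finite := by
  let values (I : Ideal D) : Set K := {a | ∃ f : D →ₐ[K] K, I ≤ RingHom.ker f ∧ f x = a}
  obtain ⟨I, hI, hmax⟩ := set_has_maximal_iff_noetherian.mpr ‹IsNoetherianRing D›
    {I | (values I).Infinite} ⟨⊥, by simpa [values] using hx⟩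
  have lift_mem {f : D →ₐ[K] K} (hf : I ≤ RingHom.ker f) :
      ∃ f' : D ⧸ I →ₐ[K] K, ∀ d, f' (Ideal.Quotient.mk I d) = f d :=
    ⟨Ideal.Quotient.liftₐ I f fun d hd => hf hd, fun _ => rfl⟩
  refine ⟨I, hI.mono ?_, fun g hg => ?_⟩
  · rintro _ ⟨f, hf, rfl⟩
    obtain ⟨f', hf'⟩ := lift_mem hf
    exact ⟨f', hf' x⟩
  obtain ⟨g, rfl⟩ := Ideal.Quotient.mk_surjective g
  have hlt : I < I ⊔ Ideal.span {g} := by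
    rw [left_lt_sup, Ideal.span_singleton_le_iff_mem]
    rwa [Ne, Ideal.Quotient.eq_zero_iff_mem] at hg
  refine (Set.not_infinite.mp fun h => hmax _ h hlt).subset ?_
  rintro _ ⟨f, hfg, rfl⟩
  refine ⟨f.comp (Ideal.Quotient.mkₐ K I), sup_le (fun d hd => ?_) ?_, rfl⟩
  · simp [RingHom.mem_ker, Ideal.Quotient.eq_zero_iff_mem.mpr hd]
  · simpa [Ideal.span_singleton_le_iff_mem, RingHom.mem_ker] using hfg

theorem transcendental_of_infinite_values {x : D}
    (hx : {a | ∃ f : D →ₐ[K] K, f x = a}.Infinite) : Transcendental K x := by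
  rintro ⟨q, hq, hqx⟩
  refine hx ((q.rootSet_finite K).subset ?_)
  rintro _ ⟨f, rfl⟩
  rw [Polynomial.mem_rootSet_of_ne hq, Polynomial.aeval_algHom_apply, hqx, map_zero]

theorem isDomain_of_infinite_values_finite_values {x : D}
    (hx : {a | ∃ f : D →ₐ[K] K, f x = a}.Infinite)
    (hfin : ∀ g ≠ 0, {a | ∃ f : D →ₐ[K] K, f g = 0 ∧ f x = a}.Finite) : IsDomain D := by
  obtain ⟨-, f, -⟩ := hx.nonempty
  have : Nontrivial D := f.toRingHom.domain_nontrivial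
  refine @NoZeroDivisors.to_isDomain D _ _ ⟨fun {g h} hgh => ?_⟩
  by_contra! hne
  refine hx (((hfin g hne.1).union (hfin h hne.2)).subset ?_)
  rintro _ ⟨f, rfl⟩
  rcases mul_eq_zero.mp ((map_mul f g h).symm.trans (hgh ▸ map_zero f)) with hg | hh
  exacts [.inl ⟨f, hg, rfl⟩, .inr ⟨f, hh, rfl⟩]

theorem nonempty_algHom_of_algHom_isFractionRing [IsDomain D] {C F : Type*} [Field F] [Algebra K F]
    [Algebra D F] [IsScalarTower K D F] [IsFractionRing D F]
    (hD : ∀ g : D, g ≠ 0 → ∃ f : D →ₐ[K] K, f g ≠ 0)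
    [CommRing C] [Algebra K C] [Algebra.FiniteType K C] (i : C →ₐ[K] F) :
    Nonempty (C →ₐ[K] K) := by
  classical
  obtain ⟨s, hs⟩ := Algebra.FiniteType.out (R := K) (A := C)
  obtain ⟨b, hb⟩ := IsLocalization.exist_integer_multiples_of_finset (nonZeroDivisors D) (s.image i)
  obtain ⟨f, hf⟩ := hD b (nonZeroDivisors.ne_zero b.2)
  let M := Submonoid.powers (b : D)
  have hM : M ≤ nonZeroDivisors D := Submonoid.powers_le.mpr b.2
  let B := (Localization.mapToFractionRing F M (Localization M) hM).range
  have hi : i.range ≤ B.restrictScalars K := by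
    rw [← Algebra.map_top, ← hs, AlgHom.map_adjoin, Algebra.adjoin_le_iff]
    rintro _ ⟨c, hc, rfl⟩
    obtain ⟨d, hd⟩ := hb (i c) (Finset.mem_image_of_mem i hc)
    refine (Localization.subalgebra.mem_range_mapToFractionRing_iff_ofField F M hM (Localization M)
      _).mpr ⟨d, b, Submonoid.mem_powers _, ?_⟩
    rw [hd, Algebra.smul_def, mul_right_comm, mul_inv_cancel₀, one_mul]
    exact IsFractionRing.to_map_ne_zero_of_mem_nonZeroDivisors b.2
  have hfM (y : M) : IsUnit (f y) := by
    obtain ⟨_, n, rfl⟩ := y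
    simpa using (isUnit_iff_ne_zero.mpr hf).pow n
  exact ⟨(IsLocalization.liftAlgHom (M := M) (S := B) hfM).comp
    ((Subalgebra.inclusion hi).comp i.rangeRestrict)⟩

end RationalPointsOfQuotients

theorem exists_transcendental_of_infinite_values {K D : Type u} [Field K] [CommRing D] [Algebra K D]
    [Algebra.FiniteType K D] {x : D} (hx : {a | ∃ f : D →ₐ[K] K, f x = a}.Infinite) :
    ∃ (F : Type u) (_ : Field F) (_ : Algebra K F) (i : D →ₐ[K] F),
      Algebra.EssFiniteType K F ∧ Transcendental K (i x) ∧
        ∀ (C : Type u) [CommRing C] [Algebra K C] [Algebra.FiniteType K C],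
          (C →ₐ[K] F) → Nonempty (C →ₐ[K] K) := by
  have : IsNoetherianRing D := Algebra.FiniteType.isNoetherianRing K D
  obtain ⟨I, hinf, hfin⟩ := exists_ideal_infinite_values_finite_values hx
  have : IsDomain (D ⧸ I) := isDomain_of_infinite_values_finite_values hinf hfin
  let F := FractionRing (D ⧸ I)
  refine ⟨F, inferInstance, inferInstance,
    (IsScalarTower.toAlgHom K (D ⧸ I) F).comp (Ideal.Quotient.mkₐ K I), ?_, ?_, fun C _ _ _ i => ?_⟩
  · have := Algebra.EssFiniteType.of_isLocalization F (nonZeroDivisors (D ⧸ I))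
    exact .comp K (D ⧸ I) F
  · exact (transcendental_algebraMap_iff (IsFractionRing.injective (D ⧸ I) F)).mpr
      (transcendental_of_infinite_values hinf)
  · refine nonempty_algHom_of_algHom_isFractionRing (D := D ⧸ I) (fun g hg => ?_) i
    obtain ⟨_, ⟨f, rfl⟩, hf⟩ := (hinf.sdiff (hfin g hg)).nonempty
    exact ⟨f, fun h => hf ⟨f, h, rfl⟩⟩

section SeparatingTranscendenceBases

open IntermediateField

theorem eq_zero_of_eval_map_frobenius_eq_zero {F : Type*} [Field F] {p : ℕ} [ExpChar F p]
    (hp : p.Prime) {x : F} (hx : ∀ b : F, b ^ p ≠ x) {q : F[X]} (hq : q.natDegree < p)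
    (hqx : (q.map (frobenius F p)).eval x = 0) : q = 0 := by
  have hprime : Prime (.X ^ p - .C x : F[X]) := (X_pow_sub_C_irreducible_of_prime hp hx).prime
  have hdvd : (.X ^ p - .C x : F[X]) ∣ q ^ p := by
    have h := map_dvd (Polynomial.expand F p) (Polynomial.dvd_iff_isRoot.mpr hqx)
    rwa [← Polynomial.map_expand, Polynomial.map_frobenius_expand, map_sub, Polynomial.expand_X,
      Polynomial.expand_C] at h
  refine Polynomial.eq_zero_of_dvd_of_natDegree_lt (hprime.dvd_of_dvd_pow hdvd) ?_
  rwa [Polynomial.natDegree_X_pow_sub_C]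

theorem exists_eval_map_frobenius_eq_aeval {K A : Type*} [Field K] [PerfectField K] [CommRing A]
    [Algebra K A] (p : ℕ) [ExpChar K p] [ExpChar A p] (x : A) (f : K[X]) :
    ∃ q : A[X], q.natDegree < p ∧ (q.map (frobenius A p)).eval x = Polynomial.aeval x f := by
  induction f using Polynomial.induction_on' with
  | add f g hf hg =>
    obtain ⟨q, hq, hqf⟩ := hf
    obtain ⟨r, hr, hrg⟩ := hg
    exact ⟨q + r, (Polynomial.natDegree_add_le q r).trans_lt (max_lt hq hr), by simp [hqf, hrg]⟩
  | monomial n c =>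
    obtain ⟨c, rfl⟩ := surjective_frobenius K p c
    refine ⟨.monomial (n % p) (algebraMap K A c * x ^ (n / p)),
      (Polynomial.natDegree_monomial_le _).trans_lt (n.mod_lt (expChar_pos K p)), ?_⟩
    rw [Polynomial.map_monomial, Polynomial.eval_monomial, Polynomial.aeval_monomial,
      frobenius_def, frobenius_def, mul_pow, map_pow, ← pow_mul, mul_assoc, ← pow_add,
      Nat.div_add_mod']

theorem exists_eval_map_frobenius_eq_aeval_div_aeval {K E : Type*} [Field K] [PerfectField K]
    [Field E] [Algebra K E] (p : ℕ) [ExpChar K p] [ExpChar E p] (x : E) (f g : K[X]) :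
    ∃ q : E[X], q.natDegree < p ∧
      (q.map (frobenius E p)).eval x = Polynomial.aeval x f / Polynomial.aeval x g := by
  -- `f / g = (1 / g) ^ p * (f * g ^ (p - 1))`
  obtain ⟨q, hq, hqx⟩ := exists_eval_map_frobenius_eq_aeval p x (f * g ^ (p - 1))
  refine ⟨Polynomial.C (Polynomial.aeval x g)⁻¹ * q,
    (Polynomial.natDegree_C_mul_le _ _).trans_lt hq, ?_⟩
  rw [Polynomial.map_mul, Polynomial.map_C, Polynomial.eval_mul, Polynomial.eval_C, hqx,
    frobenius_def, map_mul, map_pow, inv_pow]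
  rcases eq_or_ne (Polynomial.aeval x g) 0 with h | h
  · simp [h, (expChar_pos K p).ne']
  · rw [inv_mul_eq_iff_eq_mul₀ (pow_ne_zero p h), ← mul_div_assoc, eq_div_iff h, mul_assoc,
      pow_sub_one_mul (expChar_pos K p).ne', mul_comm]

theorem exists_eval_map_frobenius_gen_eq {K F : Type*} [Field K] [PerfectField K] [Field F]
    [Algebra K F] (p : ℕ) [ExpChar K p] {x : F} [ExpChar K⟮x⟯ p] (a : K⟮x⟯) :
    ∃ q : K⟮x⟯[X], q.natDegree < p ∧
      (q.map (frobenius K⟮x⟯ p)).eval (AdjoinSimple.gen K x) = a := by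
  obtain ⟨f, g, hfg⟩ := (mem_adjoin_simple_iff K (a : F)).mp a.2
  have ha : a = Polynomial.aeval (AdjoinSimple.gen K x) f /
      Polynomial.aeval (AdjoinSimple.gen K x) g := Subtype.ext (by simpa using hfg)
  rw [ha]
  exact exists_eval_map_frobenius_eq_aeval_div_aeval p (AdjoinSimple.gen K x) f g

theorem linearIndepOn_pow_of_forall_exists_eval_map_frobenius_eq {E F : Type*} [Field E] [Field F]
    [Algebra E F] {p : ℕ} [ExpChar E p] [ExpChar F p] (hp : p.Prime) {x : E}
    (hE : ∀ a : E, ∃ q : E[X], q.natDegree < p ∧ (q.map (frobenius E p)).eval x = a)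
    (hx : ∀ b : F, b ^ p ≠ algebraMap E F x) {s : Finset F} (hs : LinearIndepOn E id (s : Set F)) :
    LinearIndepOn E (· ^ p) (s : Set F) := by
  rw [linearIndepOn_finset_iff] at hs ⊢
  intro a ha
  choose q hq hqa using hE
  -- If `∑ a y * y ^ p = 0`, the `p`-th root of `x` is a root of `Q`, whose degree is too small.
  let Q : F[X] := ∑ y ∈ s, .C y * (q (a y)).map (algebraMap E F)
  have hQ : Q = 0 := by
    refine eq_zero_of_eval_map_frobenius_eq_zero hp hx
      ((Nat.lt_iff_le_pred hp.pos).mpr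
        (Polynomial.natDegree_sum_le_of_forall_le s _ fun y _ => ?_)) ?_
    · exact (Polynomial.natDegree_C_mul_le _ _).trans
        (Polynomial.natDegree_map_le.trans (Nat.le_pred_of_lt (hq (a y))))
    · rw [← ha, Polynomial.map_sum, Polynomial.eval_finsetSum]
      refine Finset.sum_congr rfl fun y _ => ?_
      have hcomm : (frobenius F p).comp (algebraMap E F) = (algebraMap E F).comp (frobenius E p) :=
        RingHom.ext fun c => by simp [frobenius_def]
      rw [Polynomial.map_mul, Polynomial.map_C, Polynomial.map_map, hcomm, ← Polynomial.map_map,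
        Polynomial.eval_mul, Polynomial.eval_C, Polynomial.eval_map_apply, hqa, frobenius_def,
        Algebra.smul_def, mul_comm]
  intro y hy
  suffices q (a y) = 0 by rw [← hqa (a y), this, Polynomial.map_zero, Polynomial.eval_zero]
  ext j
  refine hs (fun y => (q (a y)).coeff j) ?_ y hy
  have hj := congr(Polynomial.coeff $hQ j)
  simpa [Q, Polynomial.finsetSum_coeff, Algebra.smul_def, mul_comm] using hj

theorem exists_isTranscendenceBasis_and_isSeparable_of_forall_pow_ne {K F : Type*} [Field K]
    [PerfectField K] [Field F] [Algebra K F] [Algebra.EssFiniteType K F] {p : ℕ} [ExpChar K p]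
    (hp : p.Prime) {x : F} (hx : ∀ b : F, b ^ p ≠ x) :
    ∃ s : Finset F, IsTranscendenceBasis K⟮x⟯ ((↑) : s → F) ∧
      Algebra.IsSeparable (adjoin K⟮x⟯ (s : Set F)) F := by
  have := expChar_of_injective_algebraMap (algebraMap K F).injective p
  have := expChar_of_injective_algebraMap (algebraMap K K⟮x⟯).injective p
  have : Algebra.EssFiniteType K⟮x⟯ F := .of_comp K K⟮x⟯ F
  exact exists_isTranscendenceBasis_and_isSeparable_of_linearIndepOn_pow_of_essFiniteType p hp
    fun s hs => linearIndepOn_pow_of_forall_exists_eval_map_frobenius_eq hp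
      (exists_eval_map_frobenius_gen_eq p) hx hs

theorem notMem_adjoin_pow_of_transcendental {L F : Type*} [Field L] [Field F] [Algebra L F] {n : ℕ}
    (hn : 1 < n) {w : F} (hw : Transcendental L w) : w ∉ L⟮w ^ n⟯ := by
  intro h
  obtain ⟨f, g, hfg⟩ := (mem_adjoin_simple_iff L w).mp h
  have hg : Polynomial.aeval (w ^ n) g ≠ 0 := by
    intro hg
    rw [hg, div_zero] at hfg
    exact hw (hfg ▸ isAlgebraic_zero)
  have key : .X * Polynomial.expand L n g = Polynomial.expand L n f := by
    refine transcendental_iff_injective.mp hw ?_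
    rw [map_mul, Polynomial.aeval_X, Polynomial.expand_aeval, Polynomial.expand_aeval]
    exact (eq_div_iff hg).mp hfg
  have hg₀ : Polynomial.expand L n g ≠ 0 := fun h => hg (by
    rw [← Polynomial.expand_aeval, h, map_zero])
  have hdegree : g.natDegree * n + 1 = f.natDegree * n := by
    rw [← Polynomial.natDegree_expand, ← Polynomial.natDegree_expand, ← key,
      Polynomial.natDegree_X_mul hg₀]
  exact hn.ne' (Nat.dvd_one.mp ((Nat.dvd_add_right (dvd_mul_left n _)).mp
    (hdegree ▸ dvd_mul_left n _)))

theorem exists_pow_eq_and_forall_pow_ne_of_finiteDimensional {L F : Type*} [Field L]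
    [Field F] [Algebra L F] {p : ℕ} (hp : p.Prime) {x : F} (hx : Transcendental L x)
    [FiniteDimensional L⟮x⟯ F] :
    ∃ k w, w ^ p ^ k = x ∧ ∀ b : F, b ^ p ≠ w := by
  induction h : Module.finrank L⟮x⟯ F using Nat.strong_induction_on generalizing x with
  | _ n ih =>
    by_cases hpow : ∀ b : F, b ^ p ≠ x
    · exact ⟨0, x, by rw [pow_zero, pow_one], hpow⟩
    push Not at hpow
    obtain ⟨b, rfl⟩ := hpow
    have hb : Transcendental L b := fun h => hx (h.pow p)
    have hle : L⟮b ^ p⟯ ≤ L⟮b⟯ := adjoin_simple_le_iff.mpr (pow_mem (mem_adjoin_simple_self L b) p)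
    have hlt : L⟮b ^ p⟯ < L⟮b⟯ := lt_of_le_not_ge hle fun h =>
      notMem_adjoin_pow_of_transcendental hp.one_lt hb (h (mem_adjoin_simple_self L b))
    let := (inclusion hle).toAlgebra
    have : IsScalarTower L⟮b ^ p⟯ L⟮b⟯ F := .of_algebraMap_eq' rfl
    have : FiniteDimensional L⟮b⟯ F := .right L⟮b ^ p⟯ L⟮b⟯ F
    obtain ⟨k, w, hw, hwp⟩ := ih _ (h ▸ finrank_lt_of_gt hlt) hb rfl
    exact ⟨k + 1, w, by rw [pow_succ, pow_mul, hw], hwp⟩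

theorem exists_finiteDimensional_adjoin_simple_of_transcendental {K F : Type*} [Field K] [Field F]
    [Algebra K F] [Algebra.EssFiniteType K F] {x : F} (hx : Transcendental K x) :
    ∃ L : IntermediateField K F, Transcendental L x ∧ FiniteDimensional L⟮x⟯ F := by
  obtain ⟨t, hxt, ht⟩ := exists_isTranscendenceBasis_superset (R := K) (s := {x})
    ((algebraicIndependent_singleton_iff (⟨x, rfl⟩ : ({x} : Set F))).mpr hx)
  let x' : t := ⟨x, Set.singleton_subset_iff.mp hxt⟩
  let L := adjoin K ((↑) '' ({x'}ᶜ : Set t) : Set F)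
  refine ⟨L, transcendental_adjoin_iff.mpr (ht.1.transcendental_adjoin (i := x') (by simp)), ?_⟩
  let M := L⟮x⟯.restrictScalars K
  have hle : Algebra.adjoin K (Set.range ((↑) : t → F)) ≤ M.toSubalgebra := by
    rw [Algebra.adjoin_le_iff]
    rintro _ ⟨y, rfl⟩
    by_cases hy : y = x'
    · exact hy ▸ mem_adjoin_simple_self L x
    · exact L⟮x⟯.algebraMap_mem ⟨y, subset_adjoin K _ ⟨y, hy, rfl⟩⟩
  have : Algebra.IsAlgebraic M F :=
    ⟨fun y => (ht.isAlgebraic.isAlgebraic y).tower_top_of_subalgebra_le hle⟩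
  have : Algebra.EssFiniteType M F := .of_comp K M F
  exact Algebra.finite_of_essFiniteType_of_isAlgebraic (F := M)

theorem exists_pow_eq_and_exists_isTranscendenceBasis_and_isSeparable {K F : Type*} [Field K]
    [PerfectField K] [Field F] [Algebra K F] [Algebra.EssFiniteType K F] (p : ℕ) [ExpChar K p]
    {x : F} (hx : Transcendental K x) :
    ∃ (k : ℕ) (w : F) (s : Finset F), w ^ p ^ k = x ∧
      IsTranscendenceBasis K⟮w⟯ ((↑) : s → F) ∧
        Algebra.IsSeparable (adjoin K⟮w⟯ (s : Set F)) F := by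
  cases ‹ExpChar K p› with
  | zero =>
    have : CharZero K⟮x⟯ := charZero_of_injective_algebraMap (algebraMap K K⟮x⟯).injective
    have : Algebra.EssFiniteType K⟮x⟯ F := .of_comp K K⟮x⟯ F
    obtain ⟨s, hs⟩ := exists_isTranscendenceBasis_and_isSeparable_of_perfectField K⟮x⟯ F
    exact ⟨0, x, s, pow_one x, hs⟩
  | prime hp =>
    obtain ⟨L, hL, _⟩ := exists_finiteDimensional_adjoin_simple_of_transcendental hx
    have : ExpChar K p := .prime hp
    obtain ⟨k, w, hwx, hw⟩ := exists_pow_eq_and_forall_pow_ne_of_finiteDimensional hp hL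
    obtain ⟨s, hs⟩ := exists_isTranscendenceBasis_and_isSeparable_of_forall_pow_ne (K := K) hp hw
    exact ⟨k, w, s, hwx, hs⟩

theorem exists_mem_algebraicIndependent_pow_eq_and_isSeparable {K F : Type*} [Field K]
    [PerfectField K] [Field F] [Algebra K F] [Algebra.EssFiniteType K F] (p : ℕ) [ExpChar K p]
    {x : F} (hx : Transcendental K x) :
    ∃ (k : ℕ) (s : Finset F), (∃ w ∈ s, w ^ p ^ k = x) ∧
      AlgebraicIndependent K ((↑) : s → F) ∧ Algebra.IsSeparable (adjoin K (s : Set F)) F := by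
  classical
  obtain ⟨k, w, s, rfl, hs, hsep⟩ :=
    exists_pow_eq_and_exists_isTranscendenceBasis_and_isSeparable p hx
  have hw : AlgebraicIndependent K fun _ : Unit => AdjoinSimple.gen K w := by
    rw [algebraicIndependent_unique_type_iff]
    exact fun h => hx (by simpa using (h.algebraMap (A := F)).pow (p ^ k))
  have hrange : Set.range (Sum.elim ((↑) : s → F) (algebraMap K⟮w⟯ F ∘ fun _ : Unit =>
      AdjoinSimple.gen K w)) = (insert w s : Finset F) := by
    ext y
    simp [eq_comm, or_comm]
  refine ⟨k, insert w s, ⟨w, Finset.mem_insert_self w s, rfl⟩, ?_, ?_⟩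
  · have := (hw.sumElim_comp hs.1).coe_range
    rwa [hrange] at this
  · have : (adjoin K⟮w⟯ (s : Set F)).restrictScalars K = adjoin K (insert w s : Finset F) := by
      rw [adjoin_adjoin_left, Finset.coe_insert, Set.insert_eq]
    rw [← this]
    exact hsep

end SeparatingTranscendenceBases

open scoped IntermediateField.algebraAdjoinAdjoin in
theorem formallyEtale_aeval_of_algebraicIndependent {K F ι : Type*} [Field K] [Field F]
    [Algebra K F] {v : ι → F} (hv : AlgebraicIndependent K v)
    [Algebra.IsSeparable (IntermediateField.adjoin K (Set.range v)) F] :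
    (MvPolynomial.aeval v : MvPolynomial ι K →ₐ[K] F).toRingHom.FormallyEtale := by
  let A := Algebra.adjoin K (Set.range v)
  let E := IntermediateField.adjoin K (Set.range v)
  have hA : (hv.aevalEquiv : MvPolynomial ι K →+* A).FormallyEtale := by
    algebraize [(hv.aevalEquiv : MvPolynomial ι K →+* A)]
    exact .of_equiv (AlgEquiv.ofBijective (Algebra.ofId _ _) hv.aevalEquiv.bijective)
  have : Algebra.FormallyEtale A E := .of_isLocalization (nonZeroDivisors A)
  have : Algebra.FormallyEtale E F := .of_isSeparable E F
  have : Algebra.FormallyEtale A F := .comp A E F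
  convert hA.comp (RingHom.formallyEtale_algebraMap.mpr this) using 1
  ext <;> simp

theorem exists_etale_subalgebra_ge {R F : Type*} [CommRing R] [IsNoetherianRing R] [Field F]
    [Algebra R F] [Algebra.EssFiniteType R F] [Algebra.FormallyEtale R F] {B₀ : Subalgebra R F}
    (hB₀ : B₀.FG) : ∃ B : Subalgebra R F, B₀ ≤ B ∧ Algebra.Etale R B := by
  let A := B₀ ⊔ Algebra.EssFiniteType.subalgebra R F
  have : IsFractionRing A F := .of_field _ _ fun z => by
    obtain ⟨a, s, rfl⟩ := IsLocalization.exists_mk'_eq (Algebra.EssFiniteType.submonoid R F) z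
    refine ⟨⟨a, (le_sup_right : _ ≤ A) a.2⟩, ⟨s, (le_sup_right : _ ≤ A) s.1.2⟩, ?_⟩
    exact (eq_div_iff (IsLocalization.map_units F s).ne_zero).mpr (IsLocalization.mk'_spec F a s)
  have : Algebra.FiniteType R A :=
    (Subalgebra.fg_iff_finiteType A).mp (hB₀.sup ⟨_, rfl⟩)
  have : Algebra.FinitePresentation R A := Algebra.FinitePresentation.of_finiteType.mp this
  have : IsLocalization (⊥ : Ideal A).primeCompl F := by
    rw [Ideal.primeCompl_bot]
    infer_instance
  have : Algebra.IsEtaleAt R (⊥ : Ideal A) :=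
    .of_equiv ((IsLocalization.algEquiv (⊥ : Ideal A).primeCompl F
      (Localization.AtPrime (⊥ : Ideal A))).restrictScalars R)
  obtain ⟨f, hf, _⟩ := Algebra.exists_etale_of_isEtaleAt (R := R) (⊥ : Ideal A)
  have hM : Submonoid.powers f ≤ nonZeroDivisors A :=
    Submonoid.powers_le.mpr (mem_nonZeroDivisors_of_ne_zero hf)
  let B := Localization.subalgebra F (Submonoid.powers f) hM
  refine ⟨B.restrictScalars R, fun b hb => ?_, ?_⟩
  · exact B.algebraMap_mem ⟨b, (le_sup_left : _ ≤ A) hb⟩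
  · exact .of_equiv ((IsLocalization.algEquiv (Submonoid.powers f) (Localization.Away f)
      B).restrictScalars R)

theorem exists_etale_mvPolynomial {K D F : Type u} [Field K] [PerfectField K] (p : ℕ)
    [ExpChar K p] [CommRing D] [Algebra K D] [Algebra.FiniteType K D] [Field F] [Algebra K F]
    [Algebra.EssFiniteType K F] (i : D →ₐ[K] F) {x : D} (hx : Transcendental K (i x)) :
    ∃ (k : ℕ) (σ : Type u) (_ : Finite σ) (n : σ) (B : Type u) (_ : CommRing B) (_ : Algebra K B)
      (_ : B →ₐ[K] F) (φ : MvPolynomial σ K →ₐ[K] B) (j : D →ₐ[K] B),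
      φ.toRingHom.Etale ∧ j x = φ (.X n) ^ p ^ k := by
  obtain ⟨k, s, ⟨w, hw, hwx⟩, hs, _⟩ := exists_mem_algebraicIndependent_pow_eq_and_isSeparable p hx
  let := (MvPolynomial.aeval ((↑) : s → F) : MvPolynomial s K →ₐ[K] F).toAlgebra
  have : IsScalarTower K (MvPolynomial s K) F := .of_algHom _
  have : Algebra.EssFiniteType (MvPolynomial s K) F := .of_comp K _ F
  have : Algebra.IsSeparable (IntermediateField.adjoin K (Set.range ((↑) : s → F))) F := by
    have hrange : Set.range ((↑) : s → F) = s := Subtype.range_coe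
    rwa [hrange]
  have : Algebra.FormallyEtale (MvPolynomial s K) F :=
    RingHom.formallyEtale_algebraMap.mp (formallyEtale_aeval_of_algebraicIndependent hs)
  obtain ⟨t, ht⟩ := Algebra.FiniteType.out (R := K) (A := D)
  obtain ⟨B, hB, _⟩ := exists_etale_subalgebra_ge
    (Subalgebra.fg_def.mpr ⟨i '' t, t.finite_toSet.image i, rfl⟩ :
      (Algebra.adjoin (MvPolynomial s K) (i '' t)).FG)
  have hiB : i.range ≤ B.restrictScalars K := by
    rw [← Algebra.map_top, ← ht, AlgHom.map_adjoin, Algebra.adjoin_le_iff]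
    exact Algebra.subset_adjoin.trans hB
  refine ⟨k, s, inferInstance, ⟨w, hw⟩, B, inferInstance, inferInstance, B.val.restrictScalars K,
    IsScalarTower.toAlgHom K _ B, i.codRestrict (B.restrictScalars K) fun d => hiB ⟨d, rfl⟩,
    RingHom.etale_algebraMap.mpr inferInstance, Subtype.ext ?_⟩
  refine hwx.symm.trans (congrArg (· ^ p ^ k) ?_)
  exact (MvPolynomial.aeval_X (R := K) ((↑) : s → F) ⟨w, hw⟩).symm

theorem exists_mvPolynomial_algHom_polynomial {R σ : Type*} [CommSemiring R]
    (c : MvPolynomial σ R →ₐ[R] R) (n : σ) :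
    ∃ line : MvPolynomial σ R →ₐ[R] R[X], line (.X n) = Polynomial.X ∧
      (Polynomial.evalRingHom (c (.X n))).comp line.toRingHom = c.toRingHom := by
  classical
  let line : MvPolynomial σ R →ₐ[R] R[X] :=
    MvPolynomial.aeval (Function.update (fun m => Polynomial.C (c (.X m))) n Polynomial.X)
  refine ⟨line, by simp [line], MvPolynomial.ringHom_ext (fun r => by simp) fun m => ?_⟩
  obtain rfl | hm := eq_or_ne m n <;> simp [line, *]

theorem exists_etale_isPointImage_pow_mem {K : Type u} [Field K] [PerfectField K] (p : ℕ)
    [ExpChar K p] {S : Set (K[X] →+* K)} (hS : IsPointImage @RingHom.FiniteType S)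
    (hinf : {a | Polynomial.evalRingHom a ∈ S}.Infinite) :
    ∃ (k : ℕ) (T : Set (K[X] →+* K)), IsPointImage @RingHom.Etale T ∧
      (∃ a, Polynomial.evalRingHom a ∈ T) ∧
      ∀ b, Polynomial.evalRingHom b ∈ T → Polynomial.evalRingHom (b ^ p ^ k) ∈ S := by
  obtain ⟨D, _, φ₀, hφ₀, rfl⟩ := hS
  algebraize [φ₀, φ₀.comp Polynomial.C]
  have : Algebra.FiniteType K D := .trans (S := K[X]) inferInstance inferInstance
  have hval : {a | ∃ f : D →ₐ[K] K, f (φ₀ .X) = a}.Infinite := by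
    refine hinf.mono ?_
    rintro a ⟨g, hg⟩
    exact ⟨⟨g, fun r => (RingHom.congr_fun hg (Polynomial.C r)).trans Polynomial.eval_C⟩,
      (RingHom.congr_fun hg Polynomial.X).trans Polynomial.eval_X⟩
  obtain ⟨F, _, _, i, _, hi, hF⟩ := exists_transcendental_of_infinite_values hval
  obtain ⟨k, σ, _, n, B, _, _, ι, φ, j, hφ, hj⟩ := exists_etale_mvPolynomial p i hi
  have : Algebra.FiniteType K B := by
    algebraize [φ.toRingHom]
    have : IsScalarTower K (MvPolynomial σ K) B := .of_algHom φ
    exact .trans (S := MvPolynomial σ K) inferInstance inferInstance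
  obtain ⟨c⟩ := hF B ι
  obtain ⟨line, hlineX, hline⟩ := exists_mvPolynomial_algHom_polynomial (c.comp φ) n
  have hT : IsPointImage @RingHom.Etale (Set.range fun g : B →+* K => g.comp φ.toRingHom) :=
    ⟨B, inferInstance, φ.toRingHom, hφ, rfl⟩
  refine ⟨k, _, hT.preimage_comp RingHom.Etale.isStableUnderBaseChange line.toRingHom,
    ⟨c (φ (.X n)), c.toRingHom, hline.symm⟩, ?_⟩
  rintro b ⟨g, hg⟩
  have hgX : g (φ (.X n)) = b := by simpa [hlineX] using RingHom.congr_fun hg (.X n)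
  refine ⟨g.comp j.toRingHom, Polynomial.ringHom_ext (fun r => ?_) ?_⟩
  · have hgr : g (φ (algebraMap K _ r)) = r := by
      simpa using RingHom.congr_fun hg (algebraMap K _ r)
    change g (j (algebraMap K D r)) = _
    rw [j.commutes, ← φ.commutes, hgr, Polynomial.coe_evalRingHom, Polynomial.eval_C]
  · change g (j (φ₀ .X)) = _
    rw [hj, map_pow, hgX, Polynomial.coe_evalRingHom, Polynomial.eval_X]

theorem comap_iterateFrobenius_ne_top {K : Type*} [Field K] (p k : ℕ) [ExpChar K p]
    [PerfectRing K p] {K₁ : Subfield K} (hK₁ : K₁ ≠ ⊤) :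
    K₁.comap (iterateFrobenius K p k) ≠ ⊤ := by
  refine fun h => hK₁ (eq_top_iff.mpr fun y _ => ?_)
  obtain ⟨x, rfl⟩ := (bijective_iterateFrobenius K p k).surjective y
  exact (h ▸ Subfield.mem_top x : x ∈ K₁.comap (iterateFrobenius K p k))

end

theorem mainTheorem5 {K : Type u} [Field K] [FirstOrder.Ring.CompatibleRing K] [PerfectField K]
    (hK : IsAmpleField K) (X : Set K)
    (hX : IsExistentiallyDefinable FirstOrder.Language.ring (Set.univ : Set K) X) (hinf : X.Infinite)
    (K₁ : Subfield K) (hK₁ : K₁ ≠ ⊤) :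
    Cardinal.mk ↥(X \ (K₁ : Set K)) = Cardinal.mk K := by
  obtain ⟨p, _⟩ := ExpChar.exists K
  obtain ⟨S, hS, rfl⟩ := hX.exists_isPointImage
  obtain ⟨k, T, hT, ⟨a, ha⟩, hTS⟩ := exists_etale_isPointImage_pow_mem p hS hinf
  refine le_antisymm (Cardinal.mk_set_le _) ?_
  rw [← hK.mk_diff_subfield hT ha (comap_iterateFrobenius_ne_top p k hK₁)]
  exact Cardinal.mk_le_of_injective
    (f := fun b => ⟨iterateFrobenius K p k b, hTS b b.2.1, b.2.2⟩)
    fun b c h => Subtype.ext (iterateFrobenius_inj K p k congr(($h : K)))
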